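/- All manifolds are smooth, finite-dimensional and without boundary. For a Lie groupoid $G\rightrightarrows M$ with source $s$ and target $t$, let $C^\infty(M)^G=\{f\in C^\infty(M): s^*f=t^*f\}$ be its algebra of basic functions. Every Lie groupoid morphism from $G$ to the unit groupoid $\mathbb{R}\rightrightarrows\mathbb{R}$ is of the form $F=s^*f$ and covers $f$ for a unique $f\in C^\infty(M)^G$. Write $\mathcal{O}_x=t(s^{-1}(x))$ for the orbit of $x\in M$, an immersed submanifold of $M$ with $T_x\mathcal{O}_x=dt(\ker d_{1_x}s)$. An orbit $\mathcal{O}\subseteq M$ is a critical orbit of $f$ if $df$ vanishes at all its points, and a critical orbit is non-degenerate if at every $y\in\mathcal{O}$ the bilinear form that the Hessian $\mathcal{H}_y(f)$ induces on the normal space $T_yM/T_y\mathcal{O}$ is non-degenerate. The morphism $F=s^*f$ is a Morse Lie groupoid morphism if every critical orbit of $f$ is non-degenerate. A Lie groupoid morphism $\phi=(\phi^1,\phi^0):(K\rightrightarrows N)\to(G\rightrightarrows M)$ is a Morita fibration if it is (i) fully faithful: source, target and $\phi^1$ identify the manifold $K$ with the fibred product $(N\times N)\times_{M\times M}G$; (ii)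 essentially surjective: the map $G\times_M N\to M$, $(g,n)\mapsto t(g)$, defined on the pairs with $s(g)=\phi^0(n)$, is a surjective submersion; and (iii) $\phi^0:N\to M$ is a surjective submersion. **Proposition.** Let $K\rightrightarrows N$, $G\rightrightarrows M$, $G'\rightrightarrows M'$ be Lie groupoids and let $\phi:K\to G$ and $\psi:K\to G'$ be Morita fibrations. For every $f'\in C^\infty(M')^{G'}$ there is a unique $f\in C^\infty(M)^G$ with $f\circ\phi^0=f'\circ\psi^0$, and $f'\mapsto f$ is an isomorphism of algebras $C^\infty(M')^{G'}\to C^\infty(M)^G$. The induced bijection $$\mathrm{Hom}(G',\mathbb{R})\to\mathrm{Hom}(G,\mathbb{R}),\qquad F'=s^*f'\mapsto F=s^*f,$$ preserves Morse Lie groupoid morphisms in both directions: $F$ is Morse if and only if $F'$ is Morse. Moreover, for every $n\in N$, the orbit of $\phi^0(n)$ is a critical orbit (respectively, a non-degenerate critical orbit) of $f$ if and only if the orbit of $\psi^0(n)$ is a critical orbit (respectively, a non-degenerate critical orbit) of $f'$. -/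

import Mathlib

open scoped Manifold ContDiff

noncomputable section

namespace MorseGroupoid

/-! ### Lie groupoids -/

/-- A Lie groupoid `G ⇉ M` on a manifold `G` of arrows and a manifold `M` of objects
(finite-dimensional, smooth, without boundary).

The product `mul g h` (first `h`, then `g`) is meaningful only on the composable pairs
`G ×_M G = {(g, h) | src g = tgt h}`; its values elsewhere are irrelevant, and no law mentions them.
As `src` is a submersion, the composable pairs form an embedded submanifold of `G × G`, and
smoothness of the product is smoothness on this subset of `G × G`.
Surjectivity of `src` and `tgt` is contained in `src_unit` and `tgt_unit`. -/
structure LieGroupoid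
    (F : Type*) [NormedAddCommGroup F] [NormedSpace ℝ F] [FiniteDimensional ℝ F]
    (G : Type*) [TopologicalSpace G] [ChartedSpace F G] [IsManifold 𝓘(ℝ, F) ∞ G]
    (E : Type*) [NormedAddCommGroup E] [NormedSpace ℝ E] [FiniteDimensional ℝ E]
    (M : Type*) [TopologicalSpace M] [ChartedSpace E M] [IsManifold 𝓘(ℝ, E) ∞ M] where
  /-- the source map -/
  src : G → M
  /-- the target map -/
  tgt : G → M
  /-- the unit map -/
  unit : M → G
  /-- the inversion -/
  inv : G → G
  /-- the composition of arrows -/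
  mul : G → G → G
  isSubmersion_src : Manifold.IsSubmersion 𝓘(ℝ, F) 𝓘(ℝ, E) ∞ src
  isSubmersion_tgt : Manifold.IsSubmersion 𝓘(ℝ, F) 𝓘(ℝ, E) ∞ tgt
  contMDiff_unit : ContMDiff 𝓘(ℝ, E) 𝓘(ℝ, F) ∞ unit
  contMDiff_inv : ContMDiff 𝓘(ℝ, F) 𝓘(ℝ, F) ∞ inv
  contMDiffOn_mul : ContMDiffOn (𝓘(ℝ, F).prod 𝓘(ℝ, F)) 𝓘(ℝ, F) ∞
    (fun p : G × G => mul p.1 p.2) {p : G × G | src p.1 = tgt p.2}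
  src_unit : ∀ x, src (unit x) = x
  tgt_unit : ∀ x, tgt (unit x) = x
  src_inv : ∀ g, src (inv g) = tgt g
  tgt_inv : ∀ g, tgt (inv g) = src g
  src_mul : ∀ g h, src g = tgt h → src (mul g h) = src h
  tgt_mul : ∀ g h, src g = tgt h → tgt (mul g h) = tgt g
  mul_assoc : ∀ g h k, src g = tgt h → src h = tgt k → mul (mul g h) k = mul g (mul h k)
  unit_mul : ∀ g, mul (unit (tgt g)) g = g
  mul_unit : ∀ g, mul g (unit (src g)) = g
  inv_mul : ∀ g, mul (inv g) g = unit (src g)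
  mul_inv : ∀ g, mul g (inv g) = unit (tgt g)

/-- A morphism of Lie groupoids: smooth maps on arrows and on objects which commute with sources
and targets and preserve the composition. -/
structure LieGroupoidHom
    {F : Type*} [NormedAddCommGroup F] [NormedSpace ℝ F] [FiniteDimensional ℝ F]
    {G : Type*} [TopologicalSpace G] [ChartedSpace F G] [IsManifold 𝓘(ℝ, F) ∞ G]
    {E : Type*} [NormedAddCommGroup E] [NormedSpace ℝ E] [FiniteDimensional ℝ E]
    {M : Type*} [TopologicalSpace M] [ChartedSpace E M] [IsManifold 𝓘(ℝ, E) ∞ M]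
    {F' : Type*} [NormedAddCommGroup F'] [NormedSpace ℝ F'] [FiniteDimensional ℝ F']
    {G' : Type*} [TopologicalSpace G'] [ChartedSpace F' G'] [IsManifold 𝓘(ℝ, F') ∞ G']
    {E' : Type*} [NormedAddCommGroup E'] [NormedSpace ℝ E'] [FiniteDimensional ℝ E']
    {M' : Type*} [TopologicalSpace M'] [ChartedSpace E' M'] [IsManifold 𝓘(ℝ, E') ∞ M']
    (𝒢 : LieGroupoid F G E M) (𝒢' : LieGroupoid F' G' E' M') where
  /-- the map on arrows -/
  arrows : G → G'
  /-- the map on objects -/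
  objects : M → M'
  contMDiff_arrows : ContMDiff 𝓘(ℝ, F) 𝓘(ℝ, F') ∞ arrows
  contMDiff_objects : ContMDiff 𝓘(ℝ, E) 𝓘(ℝ, E') ∞ objects
  src_arrows : ∀ g, 𝒢'.src (arrows g) = objects (𝒢.src g)
  tgt_arrows : ∀ g, 𝒢'.tgt (arrows g) = objects (𝒢.tgt g)
  arrows_mul : ∀ g h, 𝒢.src g = 𝒢.tgt h → arrows (𝒢.mul g h) = 𝒢'.mul (arrows g) (arrows h)

section Morita

variable
    {F : Type*} [NormedAddCommGroup F] [NormedSpace ℝ F] [FiniteDimensional ℝ F]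
    {G : Type*} [TopologicalSpace G] [ChartedSpace F G] [IsManifold 𝓘(ℝ, F) ∞ G]
    {E : Type*} [NormedAddCommGroup E] [NormedSpace ℝ E] [FiniteDimensional ℝ E]
    {M : Type*} [TopologicalSpace M] [ChartedSpace E M] [IsManifold 𝓘(ℝ, E) ∞ M]
    {F' : Type*} [NormedAddCommGroup F'] [NormedSpace ℝ F'] [FiniteDimensional ℝ F']
    {G' : Type*} [TopologicalSpace G'] [ChartedSpace F' G'] [IsManifold 𝓘(ℝ, F') ∞ G']
    {E' : Type*} [NormedAddCommGroup E'] [NormedSpace ℝ E'] [FiniteDimensional ℝ E']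
    {M' : Type*} [TopologicalSpace M'] [ChartedSpace E' M'] [IsManifold 𝓘(ℝ, E') ∞ M']
    {𝒢 : LieGroupoid F G E M} {𝒢' : LieGroupoid F' G' E' M'}

/-- `φ` is fully faithful: `g ↦ ((s g, t g), φ g)` identifies the manifold `G` with the fibred
product `(M × M) ×_{M' × M'} G'`, that is, it is a smooth embedding into `M × M × G'` whose image is
the set-theoretic fibred product. -/
def LieGroupoidHom.IsFullyFaithful (φ : LieGroupoidHom 𝒢 𝒢') : Prop :=
  Manifold.IsSmoothEmbedding 𝓘(ℝ, F) ((𝓘(ℝ, E).prod 𝓘(ℝ, E)).prod 𝓘(ℝ, F')) ∞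
      (fun g : G => (((𝒢.src g, 𝒢.tgt g), φ.arrows g) : (M × M) × G')) ∧
    Set.range (fun g : G => (((𝒢.src g, 𝒢.tgt g), φ.arrows g) : (M × M) × G')) =
      {p : (M × M) × G' |
        φ.objects p.1.1 = 𝒢'.src p.2 ∧ φ.objects p.1.2 = 𝒢'.tgt p.2}

/-- `φ` is essentially surjective: the map `G' ×_{M'} M → M'`, `(g', x) ↦ t g'`, from the manifold
of pairs with `s g' = φ x` is a surjective submersion. As `s` is a submersion, the tangent space of
`G' ×_{M'} M` at `(g', x)` is the fibred product of the tangent spaces, i.e. it consists of the pairs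
`(ξ, w)` with `ds ξ = dφ w`; the last condition says that the differential
`(ξ, w) ↦ dt ξ` is onto. (The two sides of `ds ξ = dφ w` live in the tangent spaces at the equal
points `s g'` and `φ x`; both are the model space `E'`.) -/
def LieGroupoidHom.IsEssentiallySurjective (φ : LieGroupoidHom 𝒢 𝒢') : Prop :=
  (∀ y : M', ∃ (g' : G') (x : M), 𝒢'.src g' = φ.objects x ∧ 𝒢'.tgt g' = y) ∧
  ∀ (g' : G') (x : M), 𝒢'.src g' = φ.objects x →
    ∀ v : TangentSpace 𝓘(ℝ, E') (𝒢'.tgt g'),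
      ∃ (ξ : TangentSpace 𝓘(ℝ, F') g') (w : TangentSpace 𝓘(ℝ, E) x),
        (mfderiv 𝓘(ℝ, F') 𝓘(ℝ, E') 𝒢'.src g' ξ : E') =
          (mfderiv 𝓘(ℝ, E) 𝓘(ℝ, E') φ.objects x w : E') ∧
        mfderiv 𝓘(ℝ, F') 𝓘(ℝ, E') 𝒢'.tgt g' ξ = v

/-- A Morita map: a fully faithful and essentially surjective morphism of Lie groupoids. -/
structure LieGroupoidHom.IsMoritaMap (φ : LieGroupoidHom 𝒢 𝒢') : Prop where
  isFullyFaithful : φ.IsFullyFaithful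
  isEssentiallySurjective : φ.IsEssentiallySurjective

/-- A Morita fibration: a Morita map covering a surjective submersion on objects. -/
structure LieGroupoidHom.IsMoritaFibration (φ : LieGroupoidHom 𝒢 𝒢') : Prop where
  isMoritaMap : φ.IsMoritaMap
  surjective_objects : Function.Surjective φ.objects
  isSubmersion_objects : Manifold.IsSubmersion 𝓘(ℝ, E) 𝓘(ℝ, E') ∞ φ.objects

end Morita

/-! ### Real-valued morphisms and basic functions -/

universe u

theorem isSubmersion_id {E : Type u} [NormedAddCommGroup E] [NormedSpace ℝ E]
    {M : Type*} [TopologicalSpace M] [ChartedSpace E M] [IsManifold 𝓘(ℝ, E) ∞ M] :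
    Manifold.IsSubmersion 𝓘(ℝ, E) 𝓘(ℝ, E) ∞ (fun x : M => x) := by
  refine ⟨PUnit.{u + 1}, inferInstance, inferInstance, fun x => ?_⟩
  refine Manifold.IsSubmersionAtOfComplement.mk_of_charts
    (ContinuousLinearEquiv.prodUnique ℝ E PUnit.{u + 1}).symm (chartAt E x) (chartAt E x)
    (mem_chart_source E x) (mem_chart_source E x)
    (IsManifold.chart_mem_maximalAtlas x) (IsManifold.chart_mem_maximalAtlas x)
    (fun y hy => hy) ?_
  intro y hy
  exact ((chartAt E x).extend 𝓘(ℝ, E)).right_inv hy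

section Unit

variable
    (E : Type*) [NormedAddCommGroup E] [NormedSpace ℝ E] [FiniteDimensional ℝ E]
    (M : Type*) [TopologicalSpace M] [ChartedSpace E M] [IsManifold 𝓘(ℝ, E) ∞ M]

/-- The unit groupoid `M ⇉ M` of a manifold: only identity arrows. -/
def unitGroupoid : LieGroupoid E M E M where
  src x := x
  tgt x := x
  unit x := x
  inv x := x
  mul x _ := x
  isSubmersion_src := isSubmersion_id
  isSubmersion_tgt := isSubmersion_id
  contMDiff_unit := contMDiff_id
  contMDiff_inv := contMDiff_id
  contMDiffOn_mul := contMDiff_fst.contMDiffOn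
  src_unit _ := rfl
  tgt_unit _ := rfl
  src_inv _ := rfl
  tgt_inv _ := rfl
  src_mul _ _ h := h
  tgt_mul _ _ _ := rfl
  mul_assoc _ _ _ _ _ := rfl
  unit_mul _ := rfl
  mul_unit _ := rfl
  inv_mul _ := rfl
  mul_inv _ := rfl

end Unit

section Basic

variable
    {F : Type*} [NormedAddCommGroup F] [NormedSpace ℝ F] [FiniteDimensional ℝ F]
    {G : Type*} [TopologicalSpace G] [ChartedSpace F G] [IsManifold 𝓘(ℝ, F) ∞ G]
    {E : Type*} [NormedAddCommGroup E] [NormedSpace ℝ E] [FiniteDimensional ℝ E]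
    {M : Type*} [TopologicalSpace M] [ChartedSpace E M] [IsManifold 𝓘(ℝ, E) ∞ M]
    (𝒢 : LieGroupoid F G E M)

/-- Real-valued Lie groupoid morphisms, i.e. morphisms from `G ⇉ M` to the unit groupoid
`ℝ ⇉ ℝ`. -/
abbrev RealHom : Type _ := LieGroupoidHom 𝒢 (unitGroupoid ℝ ℝ)

/-- The algebra `C^∞(M)^G` of basic functions: smooth `f : M → ℝ` with `s^* f = t^* f`. -/
def basicFunctions : Subalgebra ℝ C^∞⟮𝓘(ℝ, E), M; ℝ⟯ where
  carrier := {f | ∀ g : G, f (𝒢.src g) = f (𝒢.tgt g)}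
  mul_mem' {a b} ha hb g := by
    have h1 : a (𝒢.src g) = a (𝒢.tgt g) := ha g
    have h2 : b (𝒢.src g) = b (𝒢.tgt g) := hb g
    simp [h1, h2]
  add_mem' {a b} ha hb g := by
    have h1 : a (𝒢.src g) = a (𝒢.tgt g) := ha g
    have h2 : b (𝒢.src g) = b (𝒢.tgt g) := hb g
    simp [h1, h2]
  algebraMap_mem' r g := rfl

/-- The identification of real-valued morphisms with basic functions: a morphism `F` goes to the
function `f` on objects that it covers, and a basic function `f` goes to the morphism
`F = s^* f` covering `f`. -/
def realHomEquiv : RealHom 𝒢 ≃ basicFunctions 𝒢 where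
  toFun φ := ⟨⟨φ.objects, φ.contMDiff_objects⟩, fun g =>
    (φ.src_arrows g).symm.trans (φ.tgt_arrows g)⟩
  invFun f :=
    { arrows := fun g => f.1 (𝒢.src g)
      objects := fun x => f.1 x
      contMDiff_arrows := f.1.contMDiff.comp 𝒢.isSubmersion_src.contMDiff
      contMDiff_objects := f.1.contMDiff
      src_arrows := fun _ => rfl
      tgt_arrows := fun g => f.2 g
      arrows_mul := fun g h hgh =>
        (congrArg f.1 (𝒢.src_mul g h hgh)).trans ((f.2 h).trans (congrArg f.1 hgh.symm)) }
  left_inv φ := by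
    have h : (fun g => φ.objects (𝒢.src g)) = φ.arrows :=
      funext fun g => (φ.src_arrows g).symm
    obtain ⟨a, b, _, _, _, _, _⟩ := φ
    have h' : (fun g => b (𝒢.src g)) = a := h
    subst h'
    rfl
  right_inv f := rfl

/-! ### Orbits, normal Hessians and Morse morphisms -/

/-- The orbit `t (s⁻¹ x)` of an object `x`. -/
def LieGroupoid.orbit (x : M) : Set M := 𝒢.tgt '' {g | 𝒢.src g = x}

/-- The tangent space at `x` of the orbit of `x`. The orbit is the submanifold
immersed by `t : s⁻¹(x) → M`, so its tangent space at `x = t (1_x)` is the image of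
`T_{1_x} s⁻¹(x) = ker ds` under `dt`. (`T_{t(1_x)} M` and `T_x M` are the same space, as
`t (1_x) = x`.) -/
def LieGroupoid.orbitTangentSpace (x : M) : Submodule ℝ (TangentSpace 𝓘(ℝ, E) x) where
  carrier := {v | ∃ ξ : TangentSpace 𝓘(ℝ, F) (𝒢.unit x),
    mfderiv 𝓘(ℝ, F) 𝓘(ℝ, E) 𝒢.src (𝒢.unit x) ξ = 0 ∧
      (mfderiv 𝓘(ℝ, F) 𝓘(ℝ, E) 𝒢.tgt (𝒢.unit x) ξ : E) = (v : E)}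
  zero_mem' := ⟨0, map_zero _, map_zero (mfderiv 𝓘(ℝ, F) 𝓘(ℝ, E) 𝒢.tgt (𝒢.unit x))⟩
  add_mem' := by
    rintro v w ⟨ξ, hξ, rfl⟩ ⟨η, hη, rfl⟩
    exact ⟨ξ + η, by rw [map_add, hξ, hη, add_zero],
      map_add (mfderiv 𝓘(ℝ, F) 𝓘(ℝ, E) 𝒢.tgt (𝒢.unit x)) ξ η⟩
  smul_mem' := by
    rintro c v ⟨ξ, hξ, rfl⟩
    exact ⟨c • ξ, by rw [map_smul, hξ, smul_zero],
      map_smul (mfderiv 𝓘(ℝ, F) 𝓘(ℝ, E) 𝒢.tgt (𝒢.unit x)) c ξ⟩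

/-- `x` is a critical point of `f`: the differential of `f` vanishes at `x`. -/
def IsCriticalPoint (f : M → ℝ) (x : M) : Prop := mfderiv 𝓘(ℝ, E) 𝓘(ℝ, ℝ) f x = 0

/-- The Hessian of `f` at a critical point `x`, a bilinear form on `T_x M`: the matrix of second
derivatives of `f` in the chart at `x` (through which `TangentSpace` identifies `T_x M` with the
model space `E`). At a critical point it does not depend on the chart, and it is
`(v, w) ↦ v (W f)` for any vector field `W` extending `w`. It is used at critical points only. -/
def hessian (f : M → ℝ) (x : M) : LinearMap.BilinForm ℝ (TangentSpace 𝓘(ℝ, E) x) :=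
  (fderiv ℝ (fderiv ℝ (f ∘ (extChartAt 𝓘(ℝ, E) x).symm)) (extChartAt 𝓘(ℝ, E) x x) :
    E →L[ℝ] E →L[ℝ] ℝ).toBilinForm

/-- At the point `x`, the Hessian of `f` induces a non-degenerate bilinear form on the normal space
`T_x M ⧸ T_x 𝒪` to the orbit `𝒪` of `x`, i.e. the normal Hessian at `x` is non-degenerate. -/
def LieGroupoid.NormalHessianNondegenerate (f : M → ℝ) (x : M) : Prop :=
  ∃ B : LinearMap.BilinForm ℝ (TangentSpace 𝓘(ℝ, E) x ⧸ 𝒢.orbitTangentSpace x),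
    (∀ v w : TangentSpace 𝓘(ℝ, E) x,
      B (Submodule.Quotient.mk v) (Submodule.Quotient.mk w) = hessian f x v w) ∧
    B.Nondegenerate

/-- The orbit of `x` is a critical orbit of `f`: it consists of critical points. -/
def LieGroupoid.IsCriticalOrbit (f : M → ℝ) (x : M) : Prop :=
  ∀ y ∈ 𝒢.orbit x, IsCriticalPoint (E := E) f y

/-- The orbit of `x` is a non-degenerate critical orbit of `f`: it is a critical orbit, and the
normal Hessian is non-degenerate at each of its points. -/
def LieGroupoid.IsNondegenerateCriticalOrbit (f : M → ℝ) (x : M) : Prop :=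
  𝒢.IsCriticalOrbit f x ∧ ∀ y ∈ 𝒢.orbit x, 𝒢.NormalHessianNondegenerate f y

/-- A real-valued morphism covering `f : M → ℝ` is a Morse Lie groupoid morphism if every critical
orbit of `f` is non-degenerate. -/
def IsMorse {𝒢 : LieGroupoid F G E M} (φ : RealHom 𝒢) : Prop :=
  ∀ x : M, 𝒢.IsCriticalOrbit φ.objects x → 𝒢.IsNondegenerateCriticalOrbit φ.objects x

end Basic

end MorseGroupoid

end

/-! Both legs of the span are treated alike: everything on `G` and on `G'` is compared with its
pullback to `K`.

For one Morita fibration `φ`, full faithfulness lifts unit arrows, so each fibre of `φ.objects` lies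
in a single orbit. A basic function upstairs is thus constant on these fibres and descends, smoothly
because a submersion has local sections (`bijective_pullback`). Arrows lift too, so orbits
downstairs are the images of orbits upstairs (`orbit_objects`).

Criticality transfers because the differential of `φ.objects` is onto. At a critical point the
Hessian of a pullback is the pullback of the Hessian (`hessian_comp`). The main point is
`mem_orbitTangentSpace_iff`: the preimage of the orbit tangent space under this differential is
exactly the orbit tangent space upstairs. So the differential induces an isomorphism of normal
spaces that matches the normal Hessians. -/

noncomputable section

namespace MorseGroupoid

open Set Filter Topology

/-! ### Submersions and smooth embeddings: local retractions, sections and lifts. -/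

section Submersion

variable
    {E : Type*} [NormedAddCommGroup E] [NormedSpace ℝ E]
    {M : Type*} [TopologicalSpace M] [ChartedSpace E M]
    {E' : Type*} [NormedAddCommGroup E'] [NormedSpace ℝ E']
    {M' : Type*} [TopologicalSpace M'] [ChartedSpace E' M']
    {f : M → M'} {x : M}

/-- Near a point `x`, the domain of a submersion `f` retracts smoothly onto the fibres of `f`:
`ρ (y, m)` lies in the fibre over `y`, and it is `m` if `m` lies in this fibre. -/
theorem exists_fibre_retraction (hf : Manifold.IsSubmersionAt 𝓘(ℝ, E) 𝓘(ℝ, E') ∞ f x) :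
    ∃ ρ : M' × M → M,
      ContMDiffAt (𝓘(ℝ, E').prod 𝓘(ℝ, E)) 𝓘(ℝ, E) ∞ ρ (f x, x) ∧
      (∀ᶠ p in 𝓝 (f x, x), f (ρ p) = p.1) ∧ ∀ᶠ m in 𝓝 x, ρ (f m, m) = m := by
  have hw : ∀ u ∈ hf.domChart.target,
      hf.codChart (f (hf.domChart.symm u)) = (hf.equiv u).1 := by
    intro u hu
    have hu' : u ∈ (hf.domChart.extend 𝓘(ℝ, E)).target := by simpa using hu
    simpa using hf.writtenInCharts hu'
  have hw' : ∀ m ∈ hf.domChart.source, (hf.equiv (hf.domChart m)).1 = hf.codChart (f m) := by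
    intro m hm
    rw [← hw _ (hf.domChart.map_source hm), hf.domChart.left_inv hm]
  -- In the submersion charts `f` is a linear projection: keep the fibre coordinate of the point of
  -- `M` and replace its base coordinate by that of the point of `M'`.
  let q : M' × M → E := fun p =>
    hf.equiv.symm (hf.codChart p.1, (hf.equiv (hf.domChart p.2)).2)
  have hx := hf.mem_domChart_source
  have hfx := hf.mem_codChart_source
  have hq0 : q (f x, x) = hf.domChart x := by
    simp only [q]
    rw [← hw' x hx]
    simp
  have hcod : ContMDiffAt 𝓘(ℝ, E') 𝓘(ℝ, E') ∞ hf.codChart (f x) :=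
    contMDiffAt_of_mem_maximalAtlas hf.codChart_mem_maximalAtlas hfx
  have hdom : ContMDiffAt 𝓘(ℝ, E) 𝓘(ℝ, E) ∞ hf.domChart x :=
    contMDiffAt_of_mem_maximalAtlas hf.domChart_mem_maximalAtlas hx
  have hsymm : ContMDiffAt 𝓘(ℝ, E) 𝓘(ℝ, E) ∞ hf.domChart.symm (hf.domChart x) :=
    contMDiffAt_symm_of_mem_maximalAtlas hf.domChart_mem_maximalAtlas (hf.domChart.map_source hx)
  have hq : ContMDiffAt (𝓘(ℝ, E').prod 𝓘(ℝ, E)) 𝓘(ℝ, E) ∞ q (f x, x) := by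
    have h1 : ContMDiffAt (𝓘(ℝ, E').prod 𝓘(ℝ, E)) 𝓘(ℝ, E') ∞
        (fun p : M' × M => hf.codChart p.1) (f x, x) :=
      ContMDiffAt.comp (f x, x) hcod contMDiffAt_fst
    have h2 : ContMDiffAt (𝓘(ℝ, E').prod 𝓘(ℝ, E)) 𝓘(ℝ, hf.complement) ∞
        (fun p : M' × M => (hf.equiv (hf.domChart p.2)).2) (f x, x) := by
      have h3 : ContMDiff 𝓘(ℝ, E) 𝓘(ℝ, hf.complement) ∞ (fun u : E => (hf.equiv u).2) := by
        rw [contMDiff_iff_contDiff]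
        fun_prop
      exact h3.contMDiffAt.comp (f x, x) (ContMDiffAt.comp (f x, x) hdom contMDiffAt_snd)
    exact hf.equiv.symm.contDiff.contMDiff.contMDiffAt.comp (f x, x) (h1.prodMk_space h2)
  refine ⟨fun p => hf.domChart.symm (q p), ?_, ?_, ?_⟩
  · exact ContMDiffAt.comp (f x, x) (by rw [hq0]; exact hsymm) hq
  · have e1 : ∀ᶠ p in 𝓝 (f x, x), q p ∈ hf.domChart.target :=
      hq.continuousAt.eventually (by
        rw [hq0]
        exact hf.domChart.open_target.mem_nhds (hf.domChart.map_source hx))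
    have e2 : ∀ᶠ p in 𝓝 (f x, x), p.1 ∈ hf.codChart.source :=
      continuousAt_fst.eventually (hf.codChart.open_source.mem_nhds hfx)
    filter_upwards [e1, e2] with p hp1 hp2
    refine hf.codChart.injOn
      (hf.source_subset_preimage_source (hf.domChart.map_target hp1)) hp2 ?_
    rw [hw _ hp1]
    simp [q]
  · filter_upwards [hf.domChart.open_source.mem_nhds hx] with m hm
    simp only [q]
    rw [← hw' m hm]
    simp [hf.domChart.left_inv hm]

/-- Differentiate `ρ (f m, m) = m`. The retraction thereby moves points into prescribed fibres
without disturbing a tangent vector compatible with the motion of the fibres. -/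
theorem mfderiv_fibre_retraction (hf : MDifferentiableAt 𝓘(ℝ, E) 𝓘(ℝ, E') f x)
    {ρ : M' × M → M}
    (hρ : MDifferentiableAt (𝓘(ℝ, E').prod 𝓘(ℝ, E)) 𝓘(ℝ, E) ρ (f x, x))
    (h : ∀ᶠ m in 𝓝 x, ρ (f m, m) = m) (v : E) :
    (mfderiv (𝓘(ℝ, E').prod 𝓘(ℝ, E)) 𝓘(ℝ, E) ρ (f x, x) :
      E' × E → E) ((mfderiv 𝓘(ℝ, E) 𝓘(ℝ, E') f x : E → E') v, v) = v := by
  have h1 := HasMFDerivAt.comp (f := fun m => (f m, m)) x hρ.hasMFDerivAt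
    (hf.hasMFDerivAt.prodMk (hasMFDerivAt_id x))
  have h2 := hasMFDerivAt_unique (h1.congr_of_eventuallyEq (h.mono fun m hm => hm.symm))
    (hasMFDerivAt_id x)
  exact congrArg (fun A : E →L[ℝ] E => A v) h2

theorem exists_local_section (hf : Manifold.IsSubmersionAt 𝓘(ℝ, E) 𝓘(ℝ, E') ∞ f x) :
    ∃ σ : M' → M, ContMDiffAt 𝓘(ℝ, E') 𝓘(ℝ, E) ∞ σ (f x) ∧ σ (f x) = x ∧
      ∀ᶠ y in 𝓝 (f x), f (σ y) = y := by
  obtain ⟨ρ, h1, h2, h3⟩ := exists_fibre_retraction hf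
  refine ⟨fun y => ρ (y, x), ?_, h3.self_of_nhds, ?_⟩
  · exact ContMDiffAt.comp (f x) h1 (contMDiffAt_id.prodMk contMDiffAt_const)
  · have : ContinuousAt (fun y : M' => (y, x)) (f x) := by fun_prop
    exact this.eventually h2

theorem surjective_mfderiv (hf : Manifold.IsSubmersionAt 𝓘(ℝ, E) 𝓘(ℝ, E') ∞ f x) :
    Function.Surjective (mfderiv 𝓘(ℝ, E) 𝓘(ℝ, E') f x) := by
  obtain ⟨σ, h1, h2, h3⟩ := exists_local_section hf
  have hfd : MDifferentiableAt 𝓘(ℝ, E) 𝓘(ℝ, E') f (σ (f x)) := by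
    rw [h2]
    exact hf.contMDiffAt.mdifferentiableAt (by simp)
  have h4 := hfd.hasMFDerivAt.comp (f x) (h1.mdifferentiableAt (by simp)).hasMFDerivAt
  have h5 := hasMFDerivAt_unique (h4.congr_of_eventuallyEq (h3.mono fun m hm => hm.symm))
    (hasMFDerivAt_id (f x))
  intro v
  have h6 := congrArg (fun A : E' →L[ℝ] E' => A v) h5
  rw [h2] at h6
  exact ⟨_, h6⟩

end Submersion

/-- A map into the range of a smooth embedding lifts smoothly. -/
theorem exists_lift_of_isSmoothEmbedding
    {E : Type*} [NormedAddCommGroup E] [NormedSpace ℝ E]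
    {H : Type*} [TopologicalSpace H] {I : ModelWithCorners ℝ E H}
    {M : Type*} [TopologicalSpace M] [ChartedSpace H M] [IsManifold I ∞ M]
    {E' : Type*} [NormedAddCommGroup E'] [NormedSpace ℝ E']
    {H' : Type*} [TopologicalSpace H'] {I' : ModelWithCorners ℝ E' H'}
    {M' : Type*} [TopologicalSpace M'] [ChartedSpace H' M'] [IsManifold I' ∞ M']
    {E'' : Type*} [NormedAddCommGroup E''] [NormedSpace ℝ E'']
    {H'' : Type*} [TopologicalSpace H''] {I'' : ModelWithCorners ℝ E'' H''}
    {P : Type*} [TopologicalSpace P] [ChartedSpace H'' P] [IsManifold I'' ∞ P]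
    {j : M → M'} (hj : Manifold.IsSmoothEmbedding I I' ∞ j) {x : M} {p : P} {γ : P → M'}
    (hγ : ContMDiffAt I'' I' ∞ γ p) (hp : γ p = j x) (hr : ∀ᶠ q in 𝓝 p, γ q ∈ range j) :
    ∃ κ : P → M, ContMDiffAt I'' I ∞ κ p ∧ κ p = x ∧ ∀ᶠ q in 𝓝 p, j (κ q) = γ q := by
  have : Nonempty M := ⟨x⟩
  have hinj := hj.isEmbedding.injective
  have hκp : Function.invFun j (γ p) = x := by
    rw [hp]
    exact Function.leftInverse_invFun hinj x
  have hκ : ∀ᶠ q in 𝓝 p, j (Function.invFun j (γ q)) = γ q :=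
    hr.mono fun q hq => Function.invFun_eq hq
  refine ⟨fun q => Function.invFun j (γ q), ?_, hκp, hκ⟩
  have hγ' : ContMDiffAt I'' I' ∞ (j ∘ fun q => Function.invFun j (γ q)) p :=
    hγ.congr_of_eventuallyEq hκ
  have him := (hj.isImmersion.isImmersionAt
    (Function.invFun j (γ p))).isImmersionAtOfComplement_complement
  -- The immersion criterion for smoothness requires continuity of the lift, which comes from the
  -- topological embedding.
  exact (ContMDiffAt.iff_comp_isImmersionAtOfComplement
    (f := fun q => Function.invFun j (γ q)) (x := p) him).2
    ⟨hj.isEmbedding.isInducing.continuousAt_iff.2 hγ'.continuousAt, hγ'⟩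

/-- The second derivative of a composition at a point where the derivative of the outer function
vanishes. -/
theorem fderiv_fderiv_comp_of_fderiv_eq_zero
    {E : Type*} [NormedAddCommGroup E] [NormedSpace ℝ E]
    {E' : Type*} [NormedAddCommGroup E'] [NormedSpace ℝ E']
    {A : E → E'} {x : E} {f : E' → ℝ} (hA : ContDiffAt ℝ 2 A x) (hf : ContDiffAt ℝ 2 f (A x))
    (h : fderiv ℝ f (A x) = 0) (v w : E) :
    fderiv ℝ (fderiv ℝ (f ∘ A)) x v w =
      fderiv ℝ (fderiv ℝ f) (A x) (fderiv ℝ A x v) (fderiv ℝ A x w) := by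
  have h1 : ∀ᶠ y in 𝓝 x, DifferentiableAt ℝ A y :=
    (hA.eventually (by simp)).mono fun y hy => hy.differentiableAt (by simp)
  have h2 : ∀ᶠ y in 𝓝 x, DifferentiableAt ℝ f (A y) :=
    hA.continuousAt.eventually
      ((hf.eventually (by simp)).mono fun y hy => hy.differentiableAt (by simp))
  have h3 : fderiv ℝ (f ∘ A) =ᶠ[𝓝 x] fun y => (fderiv ℝ f (A y)).comp (fderiv ℝ A y) := by
    filter_upwards [h1, h2] with y hy1 hy2
    exact fderiv_comp y hy2 hy1
  have hA' : HasFDerivAt (fderiv ℝ A) (fderiv ℝ (fderiv ℝ A) x) x :=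
    ((hA.fderiv_right (m := 1) (by norm_num)).differentiableAt (by simp)).hasFDerivAt
  have hf' : HasFDerivAt (fderiv ℝ f) (fderiv ℝ (fderiv ℝ f) (A x)) (A x) :=
    ((hf.fderiv_right (m := 1) (by norm_num)).differentiableAt (by simp)).hasFDerivAt
  -- The product rule also produces `fderiv ℝ f (A x)` composed with the second derivative of `A`;
  -- `h` kills this term.
  have h4 := (hf'.comp x h1.self_of_nhds.hasFDerivAt).clm_comp hA'
  rw [h3.fderiv_eq]
  have h5 := congrArg (fun B : E →L[ℝ] E →L[ℝ] ℝ => B v w) h4.fderiv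
  simpa [h] using h5

/-! ### Critical points and Hessians under pullback. -/

section Hessian

variable
    {E : Type*} [NormedAddCommGroup E] [NormedSpace ℝ E]
    {M : Type*} [TopologicalSpace M] [ChartedSpace E M]
    {E' : Type*} [NormedAddCommGroup E'] [NormedSpace ℝ E']
    {M' : Type*} [TopologicalSpace M'] [ChartedSpace E' M']
    {φ : M → M'} {x : M} {f : M' → ℝ}

theorem isCriticalPoint_comp_iff (hφ : MDifferentiableAt 𝓘(ℝ, E) 𝓘(ℝ, E') φ x)
    (hφ' : Function.Surjective (mfderiv 𝓘(ℝ, E) 𝓘(ℝ, E') φ x))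
    (hf : MDifferentiableAt 𝓘(ℝ, E') 𝓘(ℝ, ℝ) f (φ x)) :
    IsCriticalPoint (E := E) (f ∘ φ) x ↔ IsCriticalPoint (E := E') f (φ x) := by
  have h := mfderiv_comp x hf hφ
  unfold IsCriticalPoint
  rw [h]
  constructor
  · intro h0
    ext v
    obtain ⟨w, rfl⟩ := hφ' v
    exact congrArg (fun A : E →L[ℝ] ℝ => A w) h0
  · intro h0
    rw [h0]
    exact ContinuousLinearMap.zero_comp _

theorem hessian_comp
    [IsManifold 𝓘(ℝ, E) ∞ M] [IsManifold 𝓘(ℝ, E') ∞ M']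
    (hφ : ContMDiffAt 𝓘(ℝ, E) 𝓘(ℝ, E') ∞ φ x)
    (hf : ContMDiffAt 𝓘(ℝ, E') 𝓘(ℝ, ℝ) ∞ f (φ x)) (hc : IsCriticalPoint (E := E') f (φ x))
    (v w : TangentSpace 𝓘(ℝ, E) x) :
    hessian (E := E) (f ∘ φ) x v w = hessian (E := E') f (φ x)
      (mfderiv 𝓘(ℝ, E) 𝓘(ℝ, E') φ x v) (mfderiv 𝓘(ℝ, E) 𝓘(ℝ, E') φ x w) := by
  set c := extChartAt 𝓘(ℝ, E) x with hc_def
  set d := extChartAt 𝓘(ℝ, E') (φ x) with hd_def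
  let A : E → E' := d ∘ φ ∘ c.symm
  let g : E' → ℝ := f ∘ d.symm
  have hcx : c.symm (c x) = x := extChartAt_to_inv x
  have hAx : A (c x) = d (φ x) := by simp [A, hcx]
  have hA : ContDiffAt ℝ ∞ A (c x) := by
    have := (contMDiffAt_iff.1 hφ).2
    rwa [𝓘(ℝ, E).range_eq_univ, contDiffWithinAt_univ] at this
  have hg : ContDiffAt ℝ ∞ g (A (c x)) := by
    have := (contMDiffAt_iff.1 hf).2
    rw [hAx]
    rwa [𝓘(ℝ, E').range_eq_univ, contDiffWithinAt_univ, extChartAt_model_space_eq_id] at this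
  have hdφ : (mfderiv 𝓘(ℝ, E) 𝓘(ℝ, E') φ x : E →L[ℝ] E') = fderiv ℝ A (c x) := by
    rw [(hφ.mdifferentiableAt (by simp)).mfderiv, 𝓘(ℝ, E).range_eq_univ, fderivWithin_univ]
    rfl
  have hdf : fderiv ℝ g (A (c x)) = 0 := by
    have h := hc
    unfold IsCriticalPoint at h
    rw [(hf.mdifferentiableAt (by simp)).mfderiv, 𝓘(ℝ, E').range_eq_univ, fderivWithin_univ,
      writtenInExtChartAt, extChartAt_model_space_eq_id] at h
    rw [hAx]
    exact h
  -- The two sides are only known to agree where `φ ∘ c.symm` stays in the domain of the chart `d`,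
  -- which suffices for derivatives at `c x`.
  have hcomp : (f ∘ φ) ∘ c.symm =ᶠ[𝓝 (c x)] g ∘ A := by
    have h1 : ContinuousAt (φ ∘ c.symm) (c x) :=
      ContinuousAt.comp (by rw [hcx]; exact hφ.continuousAt) (continuousAt_extChartAt_symm x)
    have h2 : ∀ᶠ y in 𝓝 (c x), φ (c.symm y) ∈ d.source :=
      h1.eventually (by
        simp only [Function.comp_apply, hcx]
        exact extChartAt_source_mem_nhds (φ x))
    filter_upwards [h2] with y hy
    simp [g, A, d.left_inv hy]
  have key := fderiv_fderiv_comp_of_fderiv_eq_zero (hA.of_le (WithTop.coe_le_coe.2 le_top))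
    (hg.of_le (WithTop.coe_le_coe.2 le_top)) hdf v w
  rw [← hcomp.fderiv.fderiv_eq, hAx, ← hdφ] at key
  exact key

end Hessian

/-- A bilinear form on `V'` descends to a non-degenerate form on `V' ⧸ S'` if and only if its
pullback under a surjection `L : V → V'` does so on `V ⧸ L⁻¹ S'`. -/
theorem exists_quotient_nondegenerate_iff
    {V V' : Type*} [AddCommGroup V] [Module ℝ V] [AddCommGroup V'] [Module ℝ V']
    {S : Submodule ℝ V} {S' : Submodule ℝ V'} {L : V →ₗ[ℝ] V'} (hL : Function.Surjective L)
    (hS : ∀ v, v ∈ S ↔ L v ∈ S') {b : LinearMap.BilinForm ℝ V} {b' : LinearMap.BilinForm ℝ V'}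
    (hb : ∀ v w, b v w = b' (L v) (L w)) :
    (∃ B : LinearMap.BilinForm ℝ (V ⧸ S),
      (∀ v w, B (Submodule.Quotient.mk v) (Submodule.Quotient.mk w) = b v w) ∧
        B.Nondegenerate) ↔
    ∃ B : LinearMap.BilinForm ℝ (V' ⧸ S'),
      (∀ v w, B (Submodule.Quotient.mk v) (Submodule.Quotient.mk w) = b' v w) ∧
        B.Nondegenerate := by
  have hS' : S = S'.comap L := Submodule.ext hS
  -- The kernel of the induced map is the image of `L⁻¹ S' = S` in `V ⧸ S`, hence zero. Forms are
  -- then transported along this isomorphism.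
  have hbij : Function.Bijective (S.mapQ S' L hS'.le) := by
    constructor
    · rw [← LinearMap.ker_eq_bot, Submodule.ker_mapQ, ← hS', Submodule.mkQ_map_self]
    · intro y
      obtain ⟨v', rfl⟩ := Submodule.Quotient.mk_surjective _ y
      obtain ⟨v, rfl⟩ := hL v'
      exact ⟨Submodule.Quotient.mk v, rfl⟩
  let e : (V ⧸ S) ≃ₗ[ℝ] (V' ⧸ S') := LinearEquiv.ofBijective _ hbij
  have he : ∀ v, e (Submodule.Quotient.mk v) = Submodule.Quotient.mk (L v) := fun v => rfl
  have he' : ∀ v, e.symm (Submodule.Quotient.mk (L v)) = Submodule.Quotient.mk v := fun v => by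
    rw [← he, e.symm_apply_apply]
  constructor
  · rintro ⟨B, hB, hB'⟩
    refine ⟨LinearMap.BilinForm.congr e B, fun v w => ?_, hB'.congr e⟩
    obtain ⟨v, rfl⟩ := hL v
    obtain ⟨w, rfl⟩ := hL w
    rw [LinearMap.BilinForm.congr_apply, he', he', hB, hb]
  · rintro ⟨B, hB, hB'⟩
    refine ⟨LinearMap.BilinForm.congr e.symm B, fun v w => ?_, hB'.congr e.symm⟩
    rw [LinearMap.BilinForm.congr_apply, LinearEquiv.symm_symm, he, he, hB, hb]

/-! ### Differentials with values in the model spaces, avoiding tangent spaces at points that are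
equal only propositionally. -/

section Differential

variable
    {E : Type*} [NormedAddCommGroup E] [NormedSpace ℝ E]
    {H : Type*} [TopologicalSpace H] {I : ModelWithCorners ℝ E H}
    {M : Type*} [TopologicalSpace M] [ChartedSpace H M]
    {E' : Type*} [NormedAddCommGroup E'] [NormedSpace ℝ E']
    {H' : Type*} [TopologicalSpace H'] {I' : ModelWithCorners ℝ E' H'}
    {M' : Type*} [TopologicalSpace M'] [ChartedSpace H' M']
    {E'' : Type*} [NormedAddCommGroup E''] [NormedSpace ℝ E'']
    {H'' : Type*} [TopologicalSpace H''] {I'' : ModelWithCorners ℝ E'' H''}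
    {M'' : Type*} [TopologicalSpace M''] [ChartedSpace H'' M'']

/-- The differential of a map between manifolds, as a map between the model spaces. -/
def differential (I : ModelWithCorners ℝ E H) (I' : ModelWithCorners ℝ E' H') (f : M → M') (x : M) :
    E →L[ℝ] E' :=
  mfderiv I I' f x

theorem differential_comp {g : M' → M''} {f : M → M'} {x : M} {y : M'}
    (hg : MDifferentiableAt I' I'' g y) (hf : MDifferentiableAt I I' f x) (hy : f x = y) (v : E) :
    differential I I'' (fun z => g (f z)) x v =
      differential I' I'' g y (differential I I' f x v) := by
  subst hy
  exact mfderiv_comp_apply x hg hf v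

theorem differential_congr {f g : M → M'} {x : M} (h : f =ᶠ[𝓝 x] g) :
    differential I I' f x = differential I I' g x :=
  h.mfderiv_eq

theorem differential_const (y : M') (x : M) : differential I I' (fun _ => y) x = 0 :=
  mfderiv_const

theorem differential_prodMk {f : M → M'} {g : M → M''} {x : M} (hf : MDifferentiableAt I I' f x)
    (hg : MDifferentiableAt I I'' g x) (v : E) :
    differential I (I'.prod I'') (fun z => (f z, g z)) x v =
      (differential I I' f x v, differential I I'' g x v) :=
  congrArg (fun A : E →L[ℝ] E' × E'' => A v) (mfderiv_prodMk hf hg)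

theorem differential_id (x : M) (v : E) : differential I I (fun z : M => z) x v = v :=
  congrArg (fun A : E →L[ℝ] E => A v) (mfderiv_id (I := I) (x := x))

theorem differential_fst (p : M × M') (v : E × E') :
    differential (I.prod I') I (fun z : M × M' => z.1) p v = v.1 :=
  congrArg (fun A : E × E' →L[ℝ] E => A v) (mfderiv_fst (I := I) (I' := I') (x := p))

theorem differential_snd (p : M × M') (v : E × E') :
    differential (I.prod I') I' (fun z : M × M' => z.2) p v = v.2 :=
  congrArg (fun A : E × E' →L[ℝ] E' => A v) (mfderiv_snd (I := I) (I' := I') (x := p))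

end Differential

/-! ### Arrows, orbits and tangent spaces under a Morita fibration. -/

section Fibration

variable
    {F : Type*} [NormedAddCommGroup F] [NormedSpace ℝ F] [FiniteDimensional ℝ F]
    {G : Type*} [TopologicalSpace G] [ChartedSpace F G] [IsManifold 𝓘(ℝ, F) ∞ G]
    {E : Type*} [NormedAddCommGroup E] [NormedSpace ℝ E] [FiniteDimensional ℝ E]
    {M : Type*} [TopologicalSpace M] [ChartedSpace E M] [IsManifold 𝓘(ℝ, E) ∞ M]
    {F' : Type*} [NormedAddCommGroup F'] [NormedSpace ℝ F'] [FiniteDimensional ℝ F']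
    {G' : Type*} [TopologicalSpace G'] [ChartedSpace F' G'] [IsManifold 𝓘(ℝ, F') ∞ G']
    {E' : Type*} [NormedAddCommGroup E'] [NormedSpace ℝ E'] [FiniteDimensional ℝ E']
    {M' : Type*} [TopologicalSpace M'] [ChartedSpace E' M'] [IsManifold 𝓘(ℝ, E') ∞ M']
    {𝒢 : LieGroupoid F G E M} {𝒢' : LieGroupoid F' G' E' M'}

/-- Cancel one factor with the inverse. Preservation of units is not an axiom of `LieGroupoidHom`;
it follows because the image of a unit is idempotent. -/
theorem LieGroupoid.eq_unit_of_mul_self (g : G) (x : M) (hs : 𝒢.src g = x) (ht : 𝒢.tgt g = x)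
    (hg : 𝒢.mul g g = g) : g = 𝒢.unit x := by
  have h := 𝒢.mul_assoc (𝒢.inv g) g g (𝒢.src_inv g) (hs.trans ht.symm)
  rw [hg, 𝒢.inv_mul, hs] at h
  rw [← h, ← ht, 𝒢.unit_mul]

theorem LieGroupoidHom.arrows_unit (φ : LieGroupoidHom 𝒢 𝒢') (x : M) :
    φ.arrows (𝒢.unit x) = 𝒢'.unit (φ.objects x) := by
  refine LieGroupoid.eq_unit_of_mul_self _ _ ?_ ?_ ?_
  · rw [φ.src_arrows, 𝒢.src_unit]
  · rw [φ.tgt_arrows, 𝒢.tgt_unit]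
  · rw [← φ.arrows_mul _ _ ((𝒢.src_unit x).trans (𝒢.tgt_unit x).symm)]
    have h := 𝒢.unit_mul (𝒢.unit x)
    rw [𝒢.tgt_unit] at h
    rw [h]

theorem LieGroupoidHom.IsFullyFaithful.exists_arrow {φ : LieGroupoidHom 𝒢 𝒢'}
    (hφ : φ.IsFullyFaithful) {x y : M} {g' : G'} (hs : 𝒢'.src g' = φ.objects x)
    (ht : 𝒢'.tgt g' = φ.objects y) :
    ∃ g : G, 𝒢.src g = x ∧ 𝒢.tgt g = y ∧ φ.arrows g = g' := by
  have h : ((x, y), g') ∈ Set.range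
      (fun g : G => (((𝒢.src g, 𝒢.tgt g), φ.arrows g) : (M × M) × G')) := by
    rw [hφ.2]
    exact ⟨hs.symm, ht.symm⟩
  obtain ⟨g, hg⟩ := h
  simp only [Prod.mk.injEq] at hg
  exact ⟨g, hg.1.1, hg.1.2, hg.2⟩

/-- The unit at the common image lifts, so a fibre of `φ.objects` lies in one orbit. -/
theorem LieGroupoidHom.IsFullyFaithful.exists_arrow_of_objects_eq {φ : LieGroupoidHom 𝒢 𝒢'}
    (hφ : φ.IsFullyFaithful) {x y : M} (h : φ.objects x = φ.objects y) :
    ∃ g : G, 𝒢.src g = x ∧ 𝒢.tgt g = y := by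
  obtain ⟨g, hs, ht, -⟩ := hφ.exists_arrow (𝒢'.src_unit (φ.objects x))
    ((𝒢'.tgt_unit (φ.objects x)).trans h)
  exact ⟨g, hs, ht⟩

theorem LieGroupoidHom.IsMoritaFibration.orbit_objects {φ : LieGroupoidHom 𝒢 𝒢'}
    (hφ : φ.IsMoritaFibration) (x : M) :
    𝒢'.orbit (φ.objects x) = φ.objects '' 𝒢.orbit x := by
  ext y'
  constructor
  · rintro ⟨g', hs, rfl⟩
    obtain ⟨y, hy⟩ := hφ.surjective_objects (𝒢'.tgt g')
    obtain ⟨g, hgs, hgt, -⟩ := hφ.isMoritaMap.isFullyFaithful.exists_arrow hs hy.symm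
    exact ⟨y, ⟨g, hgs, hgt⟩, hy⟩
  · rintro ⟨_, ⟨g, rfl, rfl⟩, rfl⟩
    exact ⟨φ.arrows g, φ.src_arrows g, φ.tgt_arrows g⟩

theorem LieGroupoidHom.IsMoritaFibration.surjective_mfderiv_objects {φ : LieGroupoidHom 𝒢 𝒢'}
    (hφ : φ.IsMoritaFibration) (x : M) :
    Function.Surjective (mfderiv 𝓘(ℝ, E) 𝓘(ℝ, E') φ.objects x) :=
  surjective_mfderiv (hφ.isSubmersion_objects.isSubmersionAt x)

variable (𝒢) in
theorem LieGroupoid.mdifferentiable_src : MDifferentiable 𝓘(ℝ, F) 𝓘(ℝ, E) 𝒢.src :=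
  𝒢.isSubmersion_src.contMDiff.mdifferentiable (by simp)

variable (𝒢) in
theorem LieGroupoid.mdifferentiable_tgt : MDifferentiable 𝓘(ℝ, F) 𝓘(ℝ, E) 𝒢.tgt :=
  𝒢.isSubmersion_tgt.contMDiff.mdifferentiable (by simp)

theorem LieGroupoid.mem_orbitTangentSpace {x : M} {v : E} :
    (v : TangentSpace 𝓘(ℝ, E) x) ∈ 𝒢.orbitTangentSpace x ↔
      ∃ ξ : F, differential 𝓘(ℝ, F) 𝓘(ℝ, E) 𝒢.src (𝒢.unit x) ξ = 0 ∧
        differential 𝓘(ℝ, F) 𝓘(ℝ, E) 𝒢.tgt (𝒢.unit x) ξ = v :=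
  Iff.rfl

theorem LieGroupoidHom.mfderiv_objects_mem_orbitTangentSpace (φ : LieGroupoidHom 𝒢 𝒢') {x : M}
    {v : TangentSpace 𝓘(ℝ, E) x} (hv : v ∈ 𝒢.orbitTangentSpace x) :
    mfderiv 𝓘(ℝ, E) 𝓘(ℝ, E') φ.objects x v ∈ 𝒢'.orbitTangentSpace (φ.objects x) := by
  obtain ⟨ξ, hs, ht⟩ := (LieGroupoid.mem_orbitTangentSpace (E := E)).1 hv
  have d1 := φ.contMDiff_arrows.mdifferentiable (by simp) (𝒢.unit x)
  have d0 := φ.contMDiff_objects.mdifferentiable (by simp) x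
  -- Stated for a general pair `a`, `a'` so that it serves both the source and the target maps.
  have key : ∀ (a : G → M) (a' : G' → M') (_ : MDifferentiableAt 𝓘(ℝ, F) 𝓘(ℝ, E) a (𝒢.unit x))
      (_ : MDifferentiableAt 𝓘(ℝ, F') 𝓘(ℝ, E') a' (𝒢'.unit (φ.objects x)))
      (_ : a (𝒢.unit x) = x) (_ : ∀ g, a' (φ.arrows g) = φ.objects (a g)),
      differential 𝓘(ℝ, F') 𝓘(ℝ, E') a' (𝒢'.unit (φ.objects x))
        (differential 𝓘(ℝ, F) 𝓘(ℝ, F') φ.arrows (𝒢.unit x) ξ) =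
      differential 𝓘(ℝ, E) 𝓘(ℝ, E') φ.objects x
        (differential 𝓘(ℝ, F) 𝓘(ℝ, E) a (𝒢.unit x) ξ) := by
    intro a a' ha ha' hax h
    rw [← differential_comp ha' d1 (φ.arrows_unit x), ← differential_comp d0 ha hax]
    simp only [h]
  refine (LieGroupoid.mem_orbitTangentSpace (E := E')).2
    ⟨differential 𝓘(ℝ, F) 𝓘(ℝ, F') φ.arrows (𝒢.unit x) ξ, ?_, ?_⟩
  · rw [key _ _ (𝒢.mdifferentiable_src _) (𝒢'.mdifferentiable_src _) (𝒢.src_unit x) φ.src_arrows,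
      hs, map_zero]
  · rw [key _ _ (𝒢.mdifferentiable_tgt _) (𝒢'.mdifferentiable_tgt _) (𝒢.tgt_unit x) φ.tgt_arrows,
      ht]
    rfl

/-- For the converse, let `η` in the kernel of `ds` satisfy `dt η = dφ v`. Then `(0, v, η)` should
be tangent to the fibred product, hence come from an arrow direction `ξ` with `ds ξ = 0` and `dt ξ =
v`. Instead of computing that tangent space, the proof builds a smooth family of points of the
fibred product with derivative `(0, v, η)` and lifts it through the embedding. -/
theorem LieGroupoidHom.IsMoritaFibration.mem_orbitTangentSpace_iff {φ : LieGroupoidHom 𝒢 𝒢'}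
    (hφ : φ.IsMoritaFibration) {x : M} {v : TangentSpace 𝓘(ℝ, E) x} :
    v ∈ 𝒢.orbitTangentSpace x ↔
      mfderiv 𝓘(ℝ, E) 𝓘(ℝ, E') φ.objects x v ∈ 𝒢'.orbitTangentSpace (φ.objects x) := by
  refine ⟨φ.mfderiv_objects_mem_orbitTangentSpace, fun hv => ?_⟩
  obtain ⟨η, hs, ht⟩ := (LieGroupoid.mem_orbitTangentSpace (E := E')).1 hv
  change _ = differential 𝓘(ℝ, E) 𝓘(ℝ, E') φ.objects x v at ht
  have dφ := φ.contMDiff_objects.mdifferentiable (by simp) x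
  obtain ⟨ρ, hρ, hφρ, hρφ⟩ :=
    exists_fibre_retraction (hφ.isSubmersion_objects.isSubmersionAt x)
  have dρ := hρ.mdifferentiableAt (by simp)
  have hρv : differential (𝓘(ℝ, E').prod 𝓘(ℝ, E)) 𝓘(ℝ, E) ρ (φ.objects x, x)
      (differential 𝓘(ℝ, E) 𝓘(ℝ, E') φ.objects x v, v) = v :=
    mfderiv_fibre_retraction dφ dρ hρφ v
  set u := 𝒢'.unit (φ.objects x) with hu
  obtain ⟨τ, hτ, hsτ, hτs⟩ := exists_fibre_retraction (𝒢'.isSubmersion_src.isSubmersionAt u)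
  have hτη : differential (𝓘(ℝ, E').prod 𝓘(ℝ, F')) 𝓘(ℝ, F') τ (𝒢'.src u, u)
      (differential 𝓘(ℝ, F') 𝓘(ℝ, E') 𝒢'.src u η, η) = η :=
    mfderiv_fibre_retraction (𝒢'.mdifferentiable_src u) (hτ.mdifferentiableAt (by simp)) hτs η
  have hτu := hτs.self_of_nhds
  -- As `η` is killed by `ds`, the base argument of `τ` may be frozen: `dτ (0, η) = η`.
  rw [hs] at hτη
  have hsu : 𝒢'.src u = φ.objects x := 𝒢'.src_unit _
  have htu : 𝒢'.tgt u = φ.objects x := 𝒢'.tgt_unit _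
  rw [hsu] at hτ hsτ hτη hτu
  have dτ := hτ.mdifferentiableAt (by simp)
  -- a smooth retraction `c` onto the source fibre
  let c : G' → G' := fun g => τ (φ.objects x, g)
  have hcu : c u = u := hτu
  have hc : ContMDiffAt 𝓘(ℝ, F') 𝓘(ℝ, F') ∞ c u :=
    ContMDiffAt.comp u hτ (contMDiffAt_const.prodMk contMDiffAt_id)
  have dc := hc.mdifferentiableAt (by simp)
  have hsc : ∀ᶠ g in 𝓝 u, 𝒢'.src (c g) = φ.objects x := by
    have h : ContinuousAt (fun g : G' => (φ.objects x, g)) u := by fun_prop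
    exact h.eventually hsτ
  have hcη : differential 𝓘(ℝ, F') 𝓘(ℝ, F') c u η = η := by
    have di : MDifferentiableAt 𝓘(ℝ, F') 𝓘(ℝ, F') (fun g : G' => g) u := mdifferentiableAt_id
    have dk : MDifferentiableAt 𝓘(ℝ, F') 𝓘(ℝ, E') (fun _ : G' => φ.objects x) u :=
      mdifferentiableAt_const
    rw [differential_comp (f := fun g => (φ.objects x, g)) dτ (dk.prodMk di) rfl,
      differential_prodMk dk di, differential_const, differential_id]
    exact hτη
  let b : G' → M' := fun g => 𝒢'.tgt (c g)
  have hbu : b u = φ.objects x := (congrArg 𝒢'.tgt hcu).trans htu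
  have hb : ContMDiffAt 𝓘(ℝ, F') 𝓘(ℝ, E') ∞ b u :=
    ContMDiffAt.comp u 𝒢'.isSubmersion_tgt.contMDiff.contMDiffAt hc
  have db := hb.mdifferentiableAt (by simp)
  have hbη : differential 𝓘(ℝ, F') 𝓘(ℝ, E') b u η =
      differential 𝓘(ℝ, E) 𝓘(ℝ, E') φ.objects x v := by
    rw [differential_comp (𝒢'.mdifferentiable_tgt u) dc hcu, hcη, ht]
  have hb2 : ContMDiffAt (𝓘(ℝ, E).prod 𝓘(ℝ, F')) 𝓘(ℝ, E') ∞ (fun q : M × G' => b q.2) (x, u) :=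
    ContMDiffAt.comp (f := Prod.snd) (x, u) hb contMDiffAt_snd
  have hpair : ContMDiffAt (𝓘(ℝ, E).prod 𝓘(ℝ, F')) (𝓘(ℝ, E').prod 𝓘(ℝ, E)) ∞
      (fun q : M × G' => (b q.2, q.1)) (x, u) := hb2.prodMk contMDiffAt_fst
  -- Moves `q.1` into the fibre over the target of `c q.2`. Since `db η = dφ v`, the derivative of
  -- `m` sends `(v, η)` to `v`.
  let m : M × G' → M := fun q => ρ (b q.2, q.1)
  have hm : ContMDiffAt (𝓘(ℝ, E).prod 𝓘(ℝ, F')) 𝓘(ℝ, E) ∞ m (x, u) :=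
    hρ.comp_of_eq hpair (by rw [hbu])
  have hmx : m (x, u) = x := by
    change ρ (b u, x) = x
    rw [hbu]
    exact hρφ.self_of_nhds
  have hφm : ∀ᶠ q in 𝓝 (x, u), φ.objects (m q) = b q.2 := by
    have h : Tendsto (fun q : M × G' => (b q.2, q.1)) (𝓝 (x, u)) (𝓝 (φ.objects x, x)) := by
      have := hpair.continuousAt.tendsto
      rwa [hbu] at this
    exact h.eventually hφρ
  have hmv : differential (𝓘(ℝ, E).prod 𝓘(ℝ, F')) 𝓘(ℝ, E) m (x, u) (v, η) = v := by
    rw [differential_comp dρ (hpair.mdifferentiableAt (by simp)) (by rw [hbu]),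
      differential_prodMk (hb2.mdifferentiableAt (by simp)) mdifferentiableAt_fst,
      differential_comp db mdifferentiableAt_snd rfl, differential_snd, differential_fst, hbη, hρv]
  -- lift `(y, g) ↦ ((x, m (y, g)), c g)` to the arrows of `𝒢`
  have hΓ : ContMDiffAt (𝓘(ℝ, E).prod 𝓘(ℝ, F')) ((𝓘(ℝ, E).prod 𝓘(ℝ, E)).prod 𝓘(ℝ, F')) ∞
      (fun q : M × G' => ((x, m q), c q.2)) (x, u) :=
    (contMDiffAt_const.prodMk hm).prodMk (ContMDiffAt.comp (f := Prod.snd) (x, u) hc contMDiffAt_snd)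
  obtain ⟨κ, hκ, hκx, hjκ⟩ := exists_lift_of_isSmoothEmbedding
    hφ.isMoritaMap.isFullyFaithful.1 (x := 𝒢.unit x) hΓ
    (by rw [𝒢.src_unit, 𝒢.tgt_unit, φ.arrows_unit, hmx, hcu])
    (by
      rw [hφ.isMoritaMap.isFullyFaithful.2]
      have h2 : ∀ᶠ q in 𝓝 (x, u), 𝒢'.src (c q.2) = φ.objects x :=
        (continuous_snd.tendsto (x, u)).eventually hsc
      filter_upwards [hφm, h2] with q hq hq'
      exact ⟨hq'.symm, hq⟩)
  have dκ := hκ.mdifferentiableAt (by simp)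
  -- The lift has constant source and target `m`, so the required `ξ` is `dκ (v, η)`.
  have hsκ : (fun q => 𝒢.src (κ q)) =ᶠ[𝓝 (x, u)] fun _ => x :=
    hjκ.mono fun q hq => congrArg (fun p : (M × M) × G' => p.1.1) hq
  have htκ : (fun q => 𝒢.tgt (κ q)) =ᶠ[𝓝 (x, u)] m :=
    hjκ.mono fun q hq => congrArg (fun p : (M × M) × G' => p.1.2) hq
  refine (LieGroupoid.mem_orbitTangentSpace (E := E)).2
    ⟨differential (𝓘(ℝ, E).prod 𝓘(ℝ, F')) 𝓘(ℝ, F) κ (x, u) (v, η), ?_, ?_⟩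
  · rw [← differential_comp (𝒢.mdifferentiable_src _) dκ hκx, differential_congr hsκ,
      differential_const]
    rfl
  · rw [← differential_comp (𝒢.mdifferentiable_tgt _) dκ hκx, differential_congr htκ, hmv]

/-! ### Critical orbits, Morse morphisms and basic functions under a Morita fibration. -/

theorem LieGroupoidHom.IsMoritaFibration.isCriticalOrbit_comp_iff {φ : LieGroupoidHom 𝒢 𝒢'}
    (hφ : φ.IsMoritaFibration) {f : M' → ℝ} (hf : ContMDiff 𝓘(ℝ, E') 𝓘(ℝ, ℝ) ∞ f) (x : M) :
    𝒢.IsCriticalOrbit (f ∘ φ.objects) x ↔ 𝒢'.IsCriticalOrbit f (φ.objects x) := by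
  unfold LieGroupoid.IsCriticalOrbit
  rw [hφ.orbit_objects, forall_mem_image]
  refine forall₂_congr fun y _ => ?_
  exact isCriticalPoint_comp_iff (φ.contMDiff_objects.mdifferentiable (by simp) y)
    (hφ.surjective_mfderiv_objects y) (hf.mdifferentiable (by simp) _)

theorem LieGroupoidHom.IsMoritaFibration.normalHessianNondegenerate_comp_iff
    {φ : LieGroupoidHom 𝒢 𝒢'} (hφ : φ.IsMoritaFibration) {f : M' → ℝ}
    (hf : ContMDiff 𝓘(ℝ, E') 𝓘(ℝ, ℝ) ∞ f) {x : M}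
    (hc : IsCriticalPoint (E := E') f (φ.objects x)) :
    𝒢.NormalHessianNondegenerate (f ∘ φ.objects) x ↔
      𝒢'.NormalHessianNondegenerate f (φ.objects x) :=
  exists_quotient_nondegenerate_iff
    (L := (mfderiv 𝓘(ℝ, E) 𝓘(ℝ, E') φ.objects x).toLinearMap)
    (hφ.surjective_mfderiv_objects x) (fun _ => hφ.mem_orbitTangentSpace_iff)
    (hessian_comp (φ.contMDiff_objects x) (hf _) hc)

theorem LieGroupoidHom.IsMoritaFibration.isNondegenerateCriticalOrbit_comp_iff
    {φ : LieGroupoidHom 𝒢 𝒢'} (hφ : φ.IsMoritaFibration) {f : M' → ℝ}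
    (hf : ContMDiff 𝓘(ℝ, E') 𝓘(ℝ, ℝ) ∞ f) (x : M) :
    𝒢.IsNondegenerateCriticalOrbit (f ∘ φ.objects) x ↔
      𝒢'.IsNondegenerateCriticalOrbit f (φ.objects x) := by
  unfold LieGroupoid.IsNondegenerateCriticalOrbit
  rw [hφ.isCriticalOrbit_comp_iff hf]
  -- Criticality is kept as a hypothesis: the Hessians correspond only at critical points.
  refine and_congr_right fun hc => ?_
  unfold LieGroupoid.IsCriticalOrbit at hc
  rw [hφ.orbit_objects, forall_mem_image] at hc ⊢
  exact forall₂_congr fun y hy => hφ.normalHessianNondegenerate_comp_iff hf (hc hy)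

theorem LieGroupoidHom.IsMoritaFibration.isMorse_iff {φ : LieGroupoidHom 𝒢 𝒢'}
    (hφ : φ.IsMoritaFibration) {H : RealHom 𝒢} {H' : RealHom 𝒢'}
    (h : H.objects = H'.objects ∘ φ.objects) : IsMorse H ↔ IsMorse H' := by
  have hH' : ContMDiff 𝓘(ℝ, E') 𝓘(ℝ, ℝ) ∞ H'.objects := H'.contMDiff_objects
  unfold IsMorse
  rw [h, hφ.surjective_objects.forall]
  exact forall_congr' fun x => imp_congr (hφ.isCriticalOrbit_comp_iff hH' x)
    (hφ.isNondegenerateCriticalOrbit_comp_iff hH' x)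

/-- The pullback of basic functions along a morphism of Lie groupoids. -/
def LieGroupoidHom.pullback (φ : LieGroupoidHom 𝒢 𝒢') :
    basicFunctions 𝒢' →ₐ[ℝ] basicFunctions 𝒢 where
  toFun f := ⟨⟨f.1 ∘ φ.objects, f.1.contMDiff.comp φ.contMDiff_objects⟩, fun g => by
    have h := f.2 (φ.arrows g)
    rw [φ.src_arrows, φ.tgt_arrows] at h
    exact h⟩
  map_one' := rfl
  map_mul' _ _ := rfl
  map_zero' := rfl
  map_add' _ _ := rfl
  commutes' _ := rfl

theorem LieGroupoidHom.IsMoritaFibration.bijective_pullback {φ : LieGroupoidHom 𝒢 𝒢'}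
    (hφ : φ.IsMoritaFibration) : Function.Bijective φ.pullback := by
  have hff := hφ.isMoritaMap.isFullyFaithful
  constructor
  · intro f₁ f₂ h
    ext y
    obtain ⟨x, rfl⟩ := hφ.surjective_objects y
    exact congrArg (fun f : basicFunctions 𝒢 => f.1 x) h
  · intro f
    have hf : ∀ g, f.1 (𝒢.src g) = f.1 (𝒢.tgt g) := f.2
    -- An arbitrary set-theoretic section. By `hfr` the value of `f` does not depend on this choice,
    -- so smoothness may be checked with a local smooth section `σ` instead.
    let r : M' → M := Function.surjInv hφ.surjective_objects
    have hr : ∀ y, φ.objects (r y) = y := Function.surjInv_eq hφ.surjective_objects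
    have hfr : ∀ {x y}, φ.objects x = y → f.1 (r y) = f.1 x := by
      intro x y hxy
      obtain ⟨g, hs, ht⟩ := hff.exists_arrow_of_objects_eq ((hr y).trans hxy.symm)
      rw [← hs, ← ht, hf]
    have hsmooth : ContMDiff 𝓘(ℝ, E') 𝓘(ℝ, ℝ) ∞ (fun y => f.1 (r y)) := by
      intro y
      obtain ⟨x, rfl⟩ := hφ.surjective_objects y
      obtain ⟨σ, h1, -, h3⟩ := exists_local_section (hφ.isSubmersion_objects.isSubmersionAt x)
      exact (f.1.contMDiff.contMDiffAt.comp _ h1).congr_of_eventuallyEq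
        (h3.mono fun y hy => hfr hy)
    refine ⟨⟨⟨fun y => f.1 (r y), hsmooth⟩, fun g' => ?_⟩, ?_⟩
    · obtain ⟨g, hs, ht, -⟩ := hff.exists_arrow (hr (𝒢'.src g')).symm (hr (𝒢'.tgt g')).symm
      change f.1 (r (𝒢'.src g')) = f.1 (r (𝒢'.tgt g'))
      rw [← hs, ← ht, hf]
    · ext x
      exact hfr rfl

/-- A Morita fibration identifies the algebras of basic functions. -/
def LieGroupoidHom.IsMoritaFibration.pullbackEquiv {φ : LieGroupoidHom 𝒢 𝒢'}
    (hφ : φ.IsMoritaFibration) : basicFunctions 𝒢' ≃ₐ[ℝ] basicFunctions 𝒢 :=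
  AlgEquiv.ofBijective φ.pullback hφ.bijective_pullback

end Fibration

end MorseGroupoid

end

theorem proposition3
    {F : Type*} [NormedAddCommGroup F] [NormedSpace ℝ F] [FiniteDimensional ℝ F]
    {G : Type*} [TopologicalSpace G] [ChartedSpace F G] [IsManifold 𝓘(ℝ, F) ∞ G]
    {E : Type*} [NormedAddCommGroup E] [NormedSpace ℝ E] [FiniteDimensional ℝ E]
    {M : Type*} [TopologicalSpace M] [ChartedSpace E M] [IsManifold 𝓘(ℝ, E) ∞ M]
    {FK : Type*} [NormedAddCommGroup FK] [NormedSpace ℝ FK] [FiniteDimensional ℝ FK]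
    {K : Type*} [TopologicalSpace K] [ChartedSpace FK K] [IsManifold 𝓘(ℝ, FK) ∞ K]
    {EN : Type*} [NormedAddCommGroup EN] [NormedSpace ℝ EN] [FiniteDimensional ℝ EN]
    {N : Type*} [TopologicalSpace N] [ChartedSpace EN N] [IsManifold 𝓘(ℝ, EN) ∞ N]
    {F' : Type*} [NormedAddCommGroup F'] [NormedSpace ℝ F'] [FiniteDimensional ℝ F']
    {G' : Type*} [TopologicalSpace G'] [ChartedSpace F' G'] [IsManifold 𝓘(ℝ, F') ∞ G']
    {E' : Type*} [NormedAddCommGroup E'] [NormedSpace ℝ E'] [FiniteDimensional ℝ E']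
    {M' : Type*} [TopologicalSpace M'] [ChartedSpace E' M'] [IsManifold 𝓘(ℝ, E') ∞ M']
    (𝒢 : MorseGroupoid.LieGroupoid F G E M)
    (𝒦 : MorseGroupoid.LieGroupoid FK K EN N)
    (𝒢' : MorseGroupoid.LieGroupoid F' G' E' M')
    (φ : MorseGroupoid.LieGroupoidHom 𝒦 𝒢) (hφ : φ.IsMoritaFibration)
    (ψ : MorseGroupoid.LieGroupoidHom 𝒦 𝒢') (hψ : ψ.IsMoritaFibration) :
    -- the isomorphism `C^∞(M')^{G'} → C^∞(M)^G`, where `e f'` is the unique `f` with `φ^* f = ψ^* f'`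
    ∃ e : MorseGroupoid.basicFunctions 𝒢' ≃ₐ[ℝ] MorseGroupoid.basicFunctions 𝒢,
      (∀ (f' : MorseGroupoid.basicFunctions 𝒢') (f : MorseGroupoid.basicFunctions 𝒢),
        (∀ n : N, f.1 (φ.objects n) = f'.1 (ψ.objects n)) ↔ f = e f') ∧
      -- the induced bijection `Hom(G', ℝ) → Hom(G, ℝ)`, `s^* f' ↦ s^* (e f')`, preserves Morse morphisms
      (∀ H' : MorseGroupoid.RealHom 𝒢',
        MorseGroupoid.IsMorse ((MorseGroupoid.realHomEquiv 𝒢).symm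
          (e (MorseGroupoid.realHomEquiv 𝒢' H'))) ↔ MorseGroupoid.IsMorse H') ∧
      -- corresponding orbits are simultaneously (non-degenerate) critical
      ∀ (f' : MorseGroupoid.basicFunctions 𝒢') (n : N),
        (𝒢.IsCriticalOrbit (e f').1 (φ.objects n) ↔
          𝒢'.IsCriticalOrbit f'.1 (ψ.objects n)) ∧
        (𝒢.IsNondegenerateCriticalOrbit (e f').1 (φ.objects n) ↔
          𝒢'.IsNondegenerateCriticalOrbit f'.1 (ψ.objects n)) := by
  -- Pull back along `ψ`, then descend along `φ`.
  let e := hψ.pullbackEquiv.trans hφ.pullbackEquiv.symm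
  have he : ∀ f', φ.pullback (e f') = ψ.pullback f' := fun f' =>
    hφ.pullbackEquiv.apply_symm_apply (hψ.pullbackEquiv f')
  have he' : ∀ f', ((e f').1 : M → ℝ) ∘ φ.objects = f'.1 ∘ ψ.objects := fun f' =>
    funext fun n => congrArg (fun f : MorseGroupoid.basicFunctions 𝒦 => f.1 n) (he f')
  refine ⟨e, fun f' f => ⟨fun h => ?_, ?_⟩, fun H' => ?_, fun f' n => ⟨?_, ?_⟩⟩
  · refine hφ.bijective_pullback.1 ((Subtype.ext (ContMDiffMap.ext h)).trans (he f').symm)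
  · rintro rfl n
    exact congrFun (he' f') n
  -- `H` is the common pullback to `K` of both morphisms; being Morse is compared through it.
  · let H : MorseGroupoid.RealHom 𝒦 := (MorseGroupoid.realHomEquiv 𝒦).symm
      (ψ.pullback (MorseGroupoid.realHomEquiv 𝒢' H'))
    exact (hφ.isMorse_iff (H := H)
      (H' := (MorseGroupoid.realHomEquiv 𝒢).symm (e (MorseGroupoid.realHomEquiv 𝒢' H')))
      (he' (MorseGroupoid.realHomEquiv 𝒢' H')).symm).symm.trans
      (hψ.isMorse_iff (H := H) rfl)
  · rw [← hφ.isCriticalOrbit_comp_iff (e f').1.contMDiff, he',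
      hψ.isCriticalOrbit_comp_iff f'.1.contMDiff]
  · rw [← hφ.isNondegenerateCriticalOrbit_comp_iff (e f').1.contMDiff, he',
      hψ.isNondegenerateCriticalOrbit_comp_iff f'.1.contMDiff]
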